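/- A smooth dynamical system on $\mathbb{R}^k$ is a smooth ($C^\infty$) flow $\Phi\colon\mathbb{R}\times\mathbb{R}^k\to\mathbb{R}^k$, and an equilibrium of $\Phi$ is a point $x$ with $\Phi^t(x)=x$ for all $t\in\mathbb{R}$. The system is called super-linearizable if, for some integer $m\ge 0$, some real $(k+m)\times(k+m)$ matrix $A$ and some map $p\colon\mathbb{R}^k\to\mathbb{R}^m$, the map $f\colon\mathbb{R}^k\to\mathbb{R}^{k+m}$, $f(x)=(x,p(x))$, is a smooth embedding (a smooth map that is a homeomorphism onto its image and has injective derivative everywhere) satisfying $\exp(tA)\,f(x)=f(\Phi^t(x))$ for all $t\in\mathbb{R}$ and $x\in\mathbb{R}^k$. **Theorem.** For every integer $k>1$ and every integer $\ell\ge 0$ there exists a super-linearizable smooth dynamical system on $\mathbb{R}^k$ that has exactly $\ell$ equilibria, all of which are isolated. -/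

import Mathlib

open Topology
open scoped ContDiff Matrix

noncomputable section

namespace SuperLinear

/-- Euclidean space `ℝ^n`. -/
abbrev Euc (n : ℕ) : Type := EuclideanSpace ℝ (Fin n)

/-- The (complete, two-sided) flow `Φ` on `ℝ^k` is smooth: `(t, x) ↦ Φ t x` is jointly `C^∞`. -/
def IsSmoothFlow {k : ℕ} (Φ : Flow ℝ (Euc k)) : Prop :=
  ContDiff ℝ ∞ (fun q : ℝ × Euc k => Φ q.1 q.2)

/-- An equilibrium of the flow: a point that is fixed for all time. -/
def IsEquilibrium {k : ℕ} (Φ : Flow ℝ (Euc k)) (x : Euc k) : Prop :=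
  ∀ t : ℝ, Φ t x = x

/-- An isolated equilibrium: an equilibrium with a neighbourhood containing no other one. -/
def IsIsolatedEquilibrium {k : ℕ} (Φ : Flow ℝ (Euc k)) (x : Euc k) : Prop :=
  IsEquilibrium Φ x ∧ ∃ U ∈ 𝓝 x, ∀ y ∈ U, IsEquilibrium Φ y → y = x

/-- The linear flow `x ↦ exp(tA) x` on `ℝ^n` generated by the matrix `A`. -/
def linearFlow {n : ℕ} (A : Matrix (Fin n) (Fin n) ℝ) (t : ℝ) (x : Euc n) : Euc n :=
  WithLp.toLp 2 (NormedSpace.exp (t • A) *ᵥ x.ofLp)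

/-- A smooth embedding `ℝ^k → ℝ^n`: a smooth map which is a homeomorphism onto its image and
whose derivative is injective at every point. -/
structure IsSmoothEmb {k n : ℕ} (f : Euc k → Euc n) : Prop where
  smooth : ContDiff ℝ ∞ f
  embedding : IsEmbedding f
  injective_fderiv : ∀ x, Function.Injective (fderiv ℝ f x)

/-- `f` is a linearizing embedding of `Φ` into the linear flow generated by `A`. -/
structure IsLinearizingEmbedding {k n : ℕ} (Φ : Flow ℝ (Euc k))
    (A : Matrix (Fin n) (Fin n) ℝ) (f : Euc k → Euc n) : Prop where
  isSmoothEmb : IsSmoothEmb f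
  equivariant : ∀ (t : ℝ) (x : Euc k), linearFlow A t (f x) = f (Φ t x)

/-- The graph map `x ↦ (x, p x)` from `ℝ^k` to `ℝ^(k+m)`. -/
def graphMap {k m : ℕ} (p : Euc k → Euc m) (x : Euc k) : Euc (k + m) :=
  WithLp.toLp 2 (Fin.append x.ofLp (p x).ofLp)

/-- `Φ` is super-linearizable: it has a linearizing embedding of the form `x ↦ (x, p x)`. -/
def IsSuperLinearizable {k : ℕ} (Φ : Flow ℝ (Euc k)) : Prop :=
  ∃ (m : ℕ) (A : Matrix (Fin (k + m)) (Fin (k + m)) ℝ) (p : Euc k → Euc m),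
    IsLinearizingEmbedding Φ A (graphMap p)

end SuperLinear

end

/-! ### Linear flows leaving a graph invariant -/

namespace SuperLinear

/-! A linear vector field tangent to the graph of a smooth `p` has a global flow preserving that
graph. Reading this flow through the first `k` coordinates gives a super-linearizable flow whose
equilibria are the `x` with `A (x, p x) = 0` (`exists_flow_of_tangent`).

In the plane, consider u' = w, v' = βu + 2γuw, where w, β, γ are functions of (u, v) with w' = u and
β' = γ' = 0. The products β and γ may be very nonlinear, yet u, v, w, βu, βw, γuw, γ(u² + w²)
satisfy a closed linear system (`exists_flow_of_planar`). Further coordinates simply obey x' = x.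
The equilibria are the points where u, w and these further coordinates vanish, so it remains to find
planar data for which u = w = 0 has exactly l solutions.

The relations u' = w, w' = u, q' = 0 preserve the hyperboloid w² + q² = 1 + u², where u = w = 0
means q = ±1. On its universal cover, with coordinates (u, s), w = √(1+u²) cos s and q = √(1+u²) sin
s, the equilibria are u = 0, s ∈ π/2 + πℤ, and the strip 0 < s < lπ contains exactly l of them. The
strip is made into a plane by a new coordinate v = `chart l` whose derivative along the motion has
the required form with β = -step(q), γ = staircase/2 (`fderiv_chart_boost`), and which maps each
fibre u = const diffeomorphically onto ℝ (`fderiv_chart_snd_pos`, `exists_chart_eq`). The fibrewise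
inverse is smooth by `exists_contDiff_fibre_inverse`. The case l = 0 is handled by w = √(1+u²), β =
γ = 0. -/

/-- A solution of a linear, time dependent, homogeneous equation which vanishes at time `0`
vanishes identically. -/
theorem eq_zero_of_hasDerivAt_clm {E : Type*} [NormedAddCommGroup E] [NormedSpace ℝ E]
    {L : ℝ → E →L[ℝ] E} (hL : Continuous L) {δ : ℝ → E}
    (hδ : ∀ t, HasDerivAt δ (L t (δ t)) t) (h0 : δ 0 = 0) (t : ℝ) : δ t = 0 := by
  obtain ⟨C, hC⟩ := (isCompact_Icc (a := -(|t| + 1)) (b := |t| + 1)).exists_bound_of_continuousOn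
    hL.continuousOn
  have hv : ∀ s ∈ Set.Ioo (-(|t| + 1)) (|t| + 1),
      LipschitzOnWith C.toNNReal (fun x => L s x) Set.univ := by
    intro s hs
    refine ((L s).lipschitz.weaken ?_).lipschitzOnWith
    rw [← NNReal.coe_le_coe]
    exact (hC s ⟨hs.1.le, hs.2.le⟩).trans (Real.le_coe_toNNReal C)
  have key := ODE_solution_unique_of_mem_Ioo (t₀ := 0) (f := δ) (g := fun _ => (0 : E)) hv
    ⟨by have := abs_nonneg t; linarith, by have := abs_nonneg t; linarith⟩
    (fun s _ => ⟨hδ s, trivial⟩)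
    (fun s _ => ⟨by simpa using hasDerivAt_const s (0 : E), trivial⟩) h0
  exact key ⟨by have := neg_abs_le t; linarith, by have := le_abs_self t; linarith⟩

/-- If a linear vector field `(a, b)` is tangent to the graph of `p`, a solution curve which starts
on the graph stays on it. -/
theorem mem_graph_of_tangent {E F : Type*} [NormedAddCommGroup E] [NormedSpace ℝ E]
    [NormedAddCommGroup F] [NormedSpace ℝ F] {p : E → F} (hp : ContDiff ℝ 1 p)
    (a : E × F →L[ℝ] E) (b : E × F →L[ℝ] F)
    (htan : ∀ x, b (x, p x) = fderiv ℝ p x (a (x, p x)))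
    {y : ℝ → E} {r : ℝ → F} (hy : ∀ t, HasDerivAt y (a (y t, r t)) t)
    (hr : ∀ t, HasDerivAt r (b (y t, r t)) t) (h0 : r 0 = p (y 0)) (t : ℝ) :
    r t = p (y t) := by
  -- The defect δ = r - p(y) solves δ' = L(t) δ: write (y, r) = (y, p y) + (0, δ), and tangency
  -- cancels the contribution of the first summand.
  set L : ℝ → F →L[ℝ] F := fun t => b.comp (ContinuousLinearMap.inr ℝ E F) -
    (fderiv ℝ p (y t)).comp (a.comp (ContinuousLinearMap.inr ℝ E F)) with hLdef
  have hyc : Continuous y := continuous_iff_continuousAt.2 fun t => (hy t).continuousAt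
  have hL : Continuous L :=
    continuous_const.sub (((hp.continuous_fderiv one_ne_zero).comp hyc).clm_comp continuous_const)
  have hδ : ∀ t, HasDerivAt (fun t => r t - p (y t)) (L t (r t - p (y t))) t := by
    intro t
    have h1 := ((hp.differentiable one_ne_zero) (y t)).hasFDerivAt.comp_hasDerivAt t (hy t)
    have h2 := (hr t).sub h1
    refine h2.congr_deriv ?_
    have hs : ((y t, r t) : E × F) = (y t, p (y t)) + ContinuousLinearMap.inr ℝ E F (r t - p (y t)) := by
      simp
    rw [hs, map_add, map_add, map_add, htan]
    simp [hLdef]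
  exact sub_eq_zero.1 (eq_zero_of_hasDerivAt_clm hL hδ (by simp [h0]) t)

section Coordinates

variable {k m : ℕ}

/-- The first `k` coordinates of a point of `ℝ^(k+m)`. -/
noncomputable def headCLM (k m : ℕ) : Euc (k + m) →L[ℝ] Euc k :=
  LinearMap.toContinuousLinearMap
    { toFun := fun z => WithLp.toLp 2 fun i => z (Fin.castAdd m i)
      map_add' := fun _ _ => rfl
      map_smul' := fun _ _ => rfl }

/-- The last `m` coordinates of a point of `ℝ^(k+m)`. -/
noncomputable def tailCLM (k m : ℕ) : Euc (k + m) →L[ℝ] Euc m :=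
  LinearMap.toContinuousLinearMap
    { toFun := fun z => WithLp.toLp 2 fun i => z (Fin.natAdd k i)
      map_add' := fun _ _ => rfl
      map_smul' := fun _ _ => rfl }

/-- Concatenation of coordinates. -/
noncomputable def appendCLM (k m : ℕ) : Euc k × Euc m →L[ℝ] Euc (k + m) :=
  LinearMap.toContinuousLinearMap
    { toFun := fun z => WithLp.toLp 2 (Fin.append z.1.ofLp z.2.ofLp)
      map_add' := fun x y => by
        ext i; refine Fin.addCases (fun i => ?_) (fun i => ?_) i <;> simp
      map_smul' := fun c x => by
        ext i; refine Fin.addCases (fun i => ?_) (fun i => ?_) i <;> simp }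

@[simp] theorem headCLM_apply (z : Euc (k + m)) (i : Fin k) :
    headCLM k m z i = z (Fin.castAdd m i) := rfl

@[simp] theorem tailCLM_apply (z : Euc (k + m)) (i : Fin m) :
    tailCLM k m z i = z (Fin.natAdd k i) := rfl

@[simp] theorem headCLM_appendCLM (z : Euc k × Euc m) : headCLM k m (appendCLM k m z) = z.1 := by
  ext i; simp [appendCLM]

@[simp] theorem tailCLM_appendCLM (z : Euc k × Euc m) : tailCLM k m (appendCLM k m z) = z.2 := by
  ext i; simp [appendCLM]

@[simp] theorem appendCLM_head_tail (z : Euc (k + m)) :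
    appendCLM k m (headCLM k m z, tailCLM k m z) = z := by
  ext i; refine Fin.addCases (fun i => ?_) (fun i => ?_) i <;> simp [appendCLM]

theorem graphMap_eq (p : Euc k → Euc m) (x : Euc k) : graphMap p x = appendCLM k m (x, p x) := rfl

@[simp] theorem headCLM_graphMap (p : Euc k → Euc m) (x : Euc k) :
    headCLM k m (graphMap p x) = x := by simp [graphMap_eq]

@[simp] theorem tailCLM_graphMap (p : Euc k → Euc m) (x : Euc k) :
    tailCLM k m (graphMap p x) = p x := by simp [graphMap_eq]

theorem isSmoothEmb_graphMap {p : Euc k → Euc m} (hp : ContDiff ℝ ∞ p) :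
    IsSmoothEmb (graphMap p) := by
  have hs : ContDiff ℝ ∞ (graphMap p) := (appendCLM k m).contDiff.comp (contDiff_id.prodMk hp)
  refine ⟨hs, IsEmbedding.of_leftInverse (f := headCLM k m) (fun x => headCLM_graphMap p x)
    (headCLM k m).continuous hs.continuous, fun x => ?_⟩
  have h1 : HasFDerivAt (graphMap p) (fderiv ℝ (graphMap p) x) x :=
    (hs.differentiable (by simp) x).hasFDerivAt
  have h2 : HasFDerivAt (fun x => headCLM k m (graphMap p x))
      ((headCLM k m).comp (fderiv ℝ (graphMap p) x)) x :=
    (headCLM k m).hasFDerivAt.comp x h1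
  have h3 : HasFDerivAt (fun x => headCLM k m (graphMap p x)) (ContinuousLinearMap.id ℝ _) x := by
    simp only [headCLM_graphMap]; exact hasFDerivAt_id x
  have h4 := h2.unique h3
  intro u v huv
  have := congrArg (headCLM k m) huv
  have hu : ∀ u, headCLM k m (fderiv ℝ (graphMap p) x u) = u := fun u =>
    congrArg (fun g : Euc k →L[ℝ] Euc k => g u) h4
  rwa [hu, hu] at this

end Coordinates

section LinearFlow

variable {n : ℕ} (A : Matrix (Fin n) (Fin n) ℝ)

/-- The linear map `M ↦ M x`. -/
noncomputable def mulVecLM (x : Euc n) : Matrix (Fin n) (Fin n) ℝ →ₗ[ℝ] Euc n where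
  toFun M := WithLp.toLp 2 (M *ᵥ x.ofLp)
  map_add' M N := by ext i; simp [Matrix.add_mulVec]
  map_smul' c M := by ext i; simp [Matrix.smul_mulVec]

open scoped Matrix.Norms.Operator in
theorem hasDerivAt_linearFlow (x : Euc n) (t : ℝ) :
    HasDerivAt (fun t => linearFlow A t x)
      (WithLp.toLp 2 (A *ᵥ (linearFlow A t x).ofLp)) t := by
  have h := hasDerivAt_exp_smul_const' (𝕂 := ℝ) A t
  have h2 := (LinearMap.toContinuousLinearMap (mulVecLM x)).hasFDerivAt.comp_hasDerivAt t h
  refine h2.congr_deriv ?_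
  change WithLp.toLp 2 ((A * NormedSpace.exp (t • A)) *ᵥ x.ofLp) = _
  simp [linearFlow, Matrix.mulVec_mulVec]

theorem linearFlow_zero (x : Euc n) : linearFlow A 0 x = x := by
  simp [linearFlow, NormedSpace.exp_zero]

theorem linearFlow_add (s t : ℝ) (x : Euc n) :
    linearFlow A (s + t) x = linearFlow A s (linearFlow A t x) := by
  simp only [linearFlow, add_smul, Matrix.mulVec_mulVec]
  rw [Matrix.exp_add_of_commute]
  exact ((Commute.refl A).smul_left s).smul_right t

open scoped Matrix.Norms.Operator in
theorem contDiff_linearFlow : ContDiff ℝ ∞ fun q : ℝ × Euc n => linearFlow A q.1 q.2 := by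
  have he : ContDiff ℝ ∞ (NormedSpace.exp : Matrix (Fin n) (Fin n) ℝ → _) :=
    contDiff_iff_contDiffAt.2 fun x => (NormedSpace.exp_analytic (𝕂 := ℝ) x).contDiffAt
  have h1 : ContDiff ℝ ∞ fun q : ℝ × Euc n => NormedSpace.exp (q.1 • A) :=
    he.comp (contDiff_fst.smul contDiff_const)
  have h2 : ∀ i j, ContDiff ℝ ∞ fun q : ℝ × Euc n => NormedSpace.exp (q.1 • A) i j := by
    intro i j
    exact (LinearMap.toContinuousLinearMap
      (Matrix.entryLinearMap ℝ ℝ i j)).contDiff.comp h1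
  rw [contDiff_euclidean]
  intro i
  simp only [linearFlow, Matrix.mulVec, dotProduct]
  refine ContDiff.sum fun j _ => (h2 i j).mul ?_
  exact (EuclideanSpace.proj (𝕜 := ℝ) j : Euc n →L[ℝ] ℝ).contDiff.comp contDiff_snd

end LinearFlow

/-- If the linear vector field `A` is tangent to the graph of a smooth map `p`, it induces a
super-linearizable smooth flow, whose equilibria are given by the kernel of `A`. -/
theorem exists_flow_of_tangent {k m : ℕ} (A : Matrix (Fin (k + m)) (Fin (k + m)) ℝ)
    {p : Euc k → Euc m} (hp : ContDiff ℝ ∞ p)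
    (htan : ∀ x, tailCLM k m (WithLp.toLp 2 (A *ᵥ (graphMap p x).ofLp)) =
      fderiv ℝ p x (headCLM k m (WithLp.toLp 2 (A *ᵥ (graphMap p x).ofLp)))) :
    ∃ Φ : Flow ℝ (Euc k), IsSmoothFlow Φ ∧ IsSuperLinearizable Φ ∧
      ∀ x, IsEquilibrium Φ x ↔ A *ᵥ (graphMap p x).ofLp = 0 := by
  -- Invariance of the graph. It gives equivariance of `graphMap p` and the group law of the
  -- projected flow.
  have hinv : ∀ (t : ℝ) (x : Euc k),
      linearFlow A t (graphMap p x) = graphMap p (headCLM k m (linearFlow A t (graphMap p x))) := by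
    intro t x
    set Ac : Euc (k + m) →L[ℝ] Euc (k + m) := Matrix.toEuclideanCLM (𝕜 := ℝ) A with hAc
    have hAc' : ∀ z, Ac z = WithLp.toLp 2 (A *ᵥ z.ofLp) := fun z => rfl
    have hz := hasDerivAt_linearFlow A (graphMap p x)
    have := mem_graph_of_tangent (hp.of_le (by simp)) ((headCLM k m).comp (Ac.comp (appendCLM k m)))
      ((tailCLM k m).comp (Ac.comp (appendCLM k m)))
      (fun x => by simpa [hAc', graphMap_eq] using htan x)
      (y := fun t => headCLM k m (linearFlow A t (graphMap p x)))
      (r := fun t => tailCLM k m (linearFlow A t (graphMap p x)))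
      (fun t => by
        have h := (headCLM k m).hasFDerivAt.comp_hasDerivAt t (hz t)
        exact h.congr_deriv (by simp [hAc']))
      (fun t => by
        have h := (tailCLM k m).hasFDerivAt.comp_hasDerivAt t (hz t)
        exact h.congr_deriv (by simp [hAc']))
      (by simp [linearFlow_zero]) t
    rw [graphMap_eq p (headCLM k m _), ← this, appendCLM_head_tail]
  have hsm : ContDiff ℝ ∞ fun q : ℝ × Euc k => headCLM k m (linearFlow A q.1 (graphMap p q.2)) :=
    (headCLM k m).contDiff.comp ((contDiff_linearFlow A).comp
      (contDiff_fst.prodMk ((isSmoothEmb_graphMap hp).smooth.comp contDiff_snd)))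
  refine ⟨⟨fun t x => headCLM k m (linearFlow A t (graphMap p x)), hsm.continuous, ?_, ?_⟩, hsm,
    ⟨m, A, p, isSmoothEmb_graphMap hp, hinv⟩, ?_⟩
  · intro s t x
    rw [linearFlow_add, hinv t x, headCLM_graphMap]
  · intro x
    simp [linearFlow_zero]
  · intro x
    constructor
    · intro h
      have h1 : ∀ t, linearFlow A t (graphMap p x) = graphMap p x := fun t => by
        rw [hinv t x]; exact congrArg (graphMap p) (h t)
      have h2 := hasDerivAt_linearFlow A (graphMap p x) 0
      simp only [h1] at h2
      exact congrArg WithLp.ofLp (h2.unique (hasDerivAt_const 0 (graphMap p x)))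
    · intro h
      have h1 : ∀ t, linearFlow A t (graphMap p x) = graphMap p x := by
        intro t
        -- Since `A` kills the starting point, the displacement from it again solves the linear
        -- equation, with initial value zero.
        have h3 : ∀ s, HasDerivAt (fun s => linearFlow A s (graphMap p x) - graphMap p x)
            ((Matrix.toEuclideanCLM (𝕜 := ℝ) A : Euc (k + m) →L[ℝ] Euc (k + m))
              (linearFlow A s (graphMap p x) - graphMap p x)) s := by
          intro s
          have := (hasDerivAt_linearFlow A (graphMap p x) s).sub_const (graphMap p x)
          refine this.congr_deriv ?_
          change _ = WithLp.toLp 2 (A *ᵥ ((linearFlow A s (graphMap p x)).ofLp - (graphMap p x).ofLp))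
          rw [Matrix.mulVec_sub, h, sub_zero]
        exact sub_eq_zero.1 (eq_zero_of_hasDerivAt_clm continuous_const h3
          (by simp [linearFlow_zero]) t)
      intro t
      change headCLM k m (linearFlow A t (graphMap p x)) = x
      rw [h1, headCLM_graphMap]

end SuperLinear

/-! ### Super-linearizable flows from planar data -/

namespace SuperLinear

/-- The projection onto the first two coordinates. -/
noncomputable def planeCLM (d : ℕ) : Euc (d + 2) →L[ℝ] ℝ × ℝ :=
  (EuclideanSpace.proj (𝕜 := ℝ) (0 : Fin (d + 2)) : Euc (d + 2) →L[ℝ] ℝ).prod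
    (EuclideanSpace.proj (𝕜 := ℝ) (1 : Fin (d + 2)) : Euc (d + 2) →L[ℝ] ℝ)

@[simp] theorem planeCLM_apply {d : ℕ} (x : Euc (d + 2)) : planeCLM d x = (x 0, x 1) := rfl

/-- The observables which complete the state to a linear system. -/
noncomputable def observables (w β γ : ℝ × ℝ → ℝ) (z : ℝ × ℝ) : Euc 5 :=
  WithLp.toLp 2 ![w z, β z * z.1, β z * w z, γ z * z.1 * w z, γ z * (z.1 ^ 2 + w z ^ 2)]

/-- The linear vector field governing the state and the observables. -/
noncomputable def planarField (d : ℕ) :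
    (Fin (d + 2 + 5) → ℝ) →ₗ[ℝ] (Fin (d + 2 + 5) → ℝ) where
  toFun z := Fin.append
    (Fin.cons (z (Fin.natAdd (d + 2) 0))
      (Fin.cons (z (Fin.natAdd (d + 2) 1) + 2 * z (Fin.natAdd (d + 2) 3))
        fun i : Fin d => z (Fin.castAdd 5 i.succ.succ)))
    ![z (Fin.castAdd 5 0), z (Fin.natAdd (d + 2) 2), z (Fin.natAdd (d + 2) 1),
      z (Fin.natAdd (d + 2) 4), 4 * z (Fin.natAdd (d + 2) 3)]
  map_add' x y := by
    ext i
    refine Fin.addCases (fun i => ?_) (fun i => ?_) i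
    · refine Fin.cases ?_ (fun i => Fin.cases ?_ (fun i => ?_) i) i <;> simp
      ring
    · fin_cases i <;> simp [mul_add]
  map_smul' c x := by
    ext i
    refine Fin.addCases (fun i => ?_) (fun i => ?_) i
    · refine Fin.cases ?_ (fun i => Fin.cases ?_ (fun i => ?_) i) i <;> simp
      ring
    · fin_cases i <;> simp [mul_left_comm]

/-- The system closes because u' = w and w' = u give (uw)' = u² + w² and (u² + w²)' = 4uw, while the
first integrals β and γ behave as constants under the product rule. -/
theorem fderiv_observables {w β γ : ℝ × ℝ → ℝ} (hw : ContDiff ℝ ∞ w) (hβ : ContDiff ℝ ∞ β)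
    (hγ : ContDiff ℝ ∞ γ) (z X : ℝ × ℝ) (hX : X.1 = w z) (hXw : fderiv ℝ w z X = z.1)
    (hXβ : fderiv ℝ β z X = 0) (hXγ : fderiv ℝ γ z X = 0) :
    HasFDerivAt (observables w β γ) (fderiv ℝ (observables w β γ) z) z ∧
    fderiv ℝ (observables w β γ) z X =
      WithLp.toLp 2 ![z.1, β z * w z, β z * z.1, γ z * (z.1 ^ 2 + w z ^ 2),
        4 * (γ z * z.1 * w z)] := by
  have hw' : HasFDerivAt w (fderiv ℝ w z) z := (hw.differentiable (by simp) z).hasFDerivAt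
  have hβ' : HasFDerivAt β (fderiv ℝ β z) z := (hβ.differentiable (by simp) z).hasFDerivAt
  have hγ' : HasFDerivAt γ (fderiv ℝ γ z) z := (hγ.differentiable (by simp) z).hasFDerivAt
  have hu : HasFDerivAt (fun z : ℝ × ℝ => z.1) (ContinuousLinearMap.fst ℝ ℝ ℝ) z := hasFDerivAt_fst
  have hsm : ContDiff ℝ ∞ (observables w β γ) := by
    rw [contDiff_euclidean]
    intro i
    fin_cases i <;> simp [observables] <;> fun_prop
  have hd : HasFDerivAt (observables w β γ) (fderiv ℝ (observables w β γ) z) z :=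
    (hsm.differentiable (by simp) z).hasFDerivAt
  refine ⟨hd, ?_⟩
  have hcoord : ∀ i (g : ℝ × ℝ →L[ℝ] ℝ), HasFDerivAt (fun z => observables w β γ z i) g z →
      fderiv ℝ (observables w β γ) z X i = g X := by
    intro i g hg
    have := ((EuclideanSpace.proj (𝕜 := ℝ) i : Euc 5 →L[ℝ] ℝ).hasFDerivAt.comp z hd).unique hg
    exact congrArg (fun g : ℝ × ℝ →L[ℝ] ℝ => g X) this
  ext i
  fin_cases i
  · refine (hcoord 0 _ hw').trans ?_
    simp [hXw]
  · refine (hcoord 1 _ (hβ'.mul hu)).trans ?_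
    simp [hXβ, hX]
  · refine (hcoord 2 _ (hβ'.mul hw')).trans ?_
    simp [hXβ, hXw]
  · refine (hcoord 3 _ ((hγ'.mul hu).mul hw')).trans ?_
    simp [hXγ, hXw, hX]
    ring
  · refine (hcoord 4 _ (hγ'.mul ((hu.pow 2).add (hw'.pow 2)))).trans ?_
    simp [hXγ, hXw, hX]
    ring

/-- Planar data `w, β, γ` such that the vector field `(w, β u + 2 γ u w)` satisfies
`w' = u`, `β' = 0` and `γ' = 0` give a super-linearizable flow, in every dimension `d + 2`. -/
theorem exists_flow_of_planar (d : ℕ) {w β γ : ℝ × ℝ → ℝ} (hw : ContDiff ℝ ∞ w)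
    (hβ : ContDiff ℝ ∞ β) (hγ : ContDiff ℝ ∞ γ)
    (hXw : ∀ z, fderiv ℝ w z (w z, β z * z.1 + 2 * (γ z * z.1 * w z)) = z.1)
    (hXβ : ∀ z, fderiv ℝ β z (w z, β z * z.1 + 2 * (γ z * z.1 * w z)) = 0)
    (hXγ : ∀ z, fderiv ℝ γ z (w z, β z * z.1 + 2 * (γ z * z.1 * w z)) = 0) :
    ∃ Φ : Flow ℝ (Euc (d + 2)), IsSmoothFlow Φ ∧ IsSuperLinearizable Φ ∧
      ∀ x, IsEquilibrium Φ x ↔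
        x 0 = 0 ∧ w (x 0, x 1) = 0 ∧ ∀ i : Fin d, x i.succ.succ = 0 := by
  have hobs : ContDiff ℝ ∞ (observables w β γ) := by
    rw [contDiff_euclidean]
    intro i
    fin_cases i <;> simp [observables] <;> fun_prop
  set p : Euc (d + 2) → Euc 5 := fun x => observables w β γ (planeCLM d x) with hp
  have happ : ∀ x, (LinearMap.toMatrix' (planarField d)) *ᵥ (graphMap p x).ofLp =
      planarField d (graphMap p x).ofLp := fun x => by rw [LinearMap.toMatrix'_mulVec]
  have hval : ∀ x, planarField d (graphMap p x).ofLp = Fin.append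
      (Fin.cons (w (x 0, x 1))
        (Fin.cons (β (x 0, x 1) * x 0 + 2 * (γ (x 0, x 1) * x 0 * w (x 0, x 1)))
        fun i : Fin d => x i.succ.succ))
      ![x 0, β (x 0, x 1) * w (x 0, x 1), β (x 0, x 1) * x 0,
        γ (x 0, x 1) * (x 0 ^ 2 + w (x 0, x 1) ^ 2), 4 * (γ (x 0, x 1) * x 0 * w (x 0, x 1))] := by
    intro x
    simp [planarField, graphMap, hp, observables]
  obtain ⟨Φ, h1, h2, h3⟩ := exists_flow_of_tangent (LinearMap.toMatrix' (planarField d))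
    (p := p) (hobs.comp (planeCLM d).contDiff) (fun x => by
      rw [happ, hval]
      obtain ⟨hd, hX⟩ := fderiv_observables hw hβ hγ (x 0, x 1) _ rfl (hXw _) (hXβ _) (hXγ _)
      have hp' : HasFDerivAt p ((fderiv ℝ (observables w β γ) (x 0, x 1)).comp (planeCLM d)) x :=
        HasFDerivAt.comp (g := observables w β γ) (f := planeCLM d) x hd (planeCLM d).hasFDerivAt
      rw [hp'.fderiv, ContinuousLinearMap.comp_apply]
      refine Eq.trans ?_ (Eq.trans hX.symm ?_)
      · ext i
        simp
      · congr 1)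
  refine ⟨Φ, h1, h2, fun x => ?_⟩
  rw [h3, happ, hval]
  constructor
  · intro h
    refine ⟨?_, ?_, fun i => ?_⟩
    · simpa using congrFun h (Fin.natAdd (d + 2) 0)
    · simpa using congrFun h (Fin.castAdd 5 0)
    · simpa using congrFun h (Fin.castAdd 5 i.succ.succ)
  · rintro ⟨h0, hw0, hi⟩
    rw [hw0, h0]
    ext i
    refine Fin.addCases (fun i => ?_) (fun i => ?_) i
    · refine Fin.cases ?_ (fun i => Fin.cases ?_ (fun i => ?_) i) i <;> simp [hi]
    · fin_cases i <;> simp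

end SuperLinear

/-! ### Fibrewise changes of coordinates in the plane -/

namespace SuperLinear

/-- A smooth function on the strip `ℝ × (a, b)` whose restriction to each fibre is an increasing
diffeomorphism onto `ℝ` can be used as a second coordinate. -/
theorem exists_contDiff_fibre_inverse {a b : ℝ} {V : ℝ × ℝ → ℝ}
    (hV : ∀ z : ℝ × ℝ, z.2 ∈ Set.Ioo a b → ContDiffAt ℝ ∞ V z)
    (hpos : ∀ z : ℝ × ℝ, z.2 ∈ Set.Ioo a b → 0 < fderiv ℝ V z (0, 1))
    (hsurj : ∀ u v, ∃ s ∈ Set.Ioo a b, V (u, s) = v) :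
    ∃ G : ℝ × ℝ → ℝ × ℝ, ContDiff ℝ ∞ G ∧
      (∀ y, (G y).2 ∈ Set.Ioo a b ∧ (G y).1 = y.1 ∧ V (G y) = y.2) ∧
      (∀ z : ℝ × ℝ, z.2 ∈ Set.Ioo a b → G (z.1, V z) = z) ∧
      ∀ (z : ℝ × ℝ) (X : ℝ × ℝ), z.2 ∈ Set.Ioo a b →
        fderiv ℝ G (z.1, V z) (X.1, fderiv ℝ V z X) = X := by
  have hVd : ∀ z : ℝ × ℝ, z.2 ∈ Set.Ioo a b → HasFDerivAt V (fderiv ℝ V z) z := fun z hz =>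
    ((hV z hz).differentiableAt (by simp)).hasFDerivAt
  have hmono : ∀ u, StrictMonoOn (fun s => V (u, s)) (Set.Ioo a b) := by
    intro u
    have hd : ∀ s ∈ Set.Ioo a b, HasDerivAt (fun s => V (u, s)) (fderiv ℝ V (u, s) (0, 1)) s := by
      intro s hs
      exact (hVd (u, s) hs).comp_hasDerivAt s ((hasDerivAt_const s u).prodMk (hasDerivAt_id s))
    refine strictMonoOn_of_deriv_pos (convex_Ioo a b)
      (fun s hs => (hd s hs).continuousAt.continuousWithinAt) fun s hs => ?_
    rw [interior_Ioo] at hs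
    rw [(hd s hs).deriv]
    exact hpos (u, s) hs
  have hinj : ∀ z z' : ℝ × ℝ, z.2 ∈ Set.Ioo a b → z'.2 ∈ Set.Ioo a b → z.1 = z'.1 → V z = V z' →
      z = z' := by
    rintro ⟨u, s⟩ ⟨u', s'⟩ hs hs' h1 h2
    obtain rfl : u = u' := h1
    exact Prod.ext rfl ((hmono u).injOn hs hs' h2)
  choose S hS hVS using hsurj
  set G : ℝ × ℝ → ℝ × ℝ := fun y => (y.1, S y.1 y.2) with hG
  have hGF : ∀ z : ℝ × ℝ, z.2 ∈ Set.Ioo a b → G (z.1, V z) = z := fun z hz =>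
    hinj _ _ (hS _ _) hz rfl (hVS _ _)
  set F : ℝ × ℝ → ℝ × ℝ := fun z => (z.1, V z) with hF
  have hFG : ∀ y, F (G y) = y := fun y => Prod.ext rfl (hVS _ _)
  have hFc : ∀ z : ℝ × ℝ, z.2 ∈ Set.Ioo a b → ContDiffAt ℝ ∞ F z := fun z hz =>
    contDiffAt_fst.prodMk (hV z hz)
  have hFd : ∀ z : ℝ × ℝ, z.2 ∈ Set.Ioo a b →
      HasFDerivAt F ((ContinuousLinearMap.fst ℝ ℝ ℝ).prod (fderiv ℝ V z)) z := fun z hz =>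
    hasFDerivAt_fst.prodMk (hVd z hz)
  have hopen : IsOpen {z : ℝ × ℝ | z.2 ∈ Set.Ioo a b} := isOpen_Ioo.preimage continuous_snd
  have hGsmooth : ContDiff ℝ ∞ G := by
    rw [contDiff_iff_contDiffAt]
    intro y
    set z := G y with hz
    have hzD : z.2 ∈ Set.Ioo a b := hS _ _
    set D := fderiv ℝ V z with hD
    have hD1 : D (0, 1) ≠ 0 := (hpos z hzD).ne'
    have hlin : ∀ x : ℝ × ℝ, D x = x.1 * D (1, 0) + x.2 * D (0, 1) := by
      intro x
      have : x = x.1 • ((1, 0) : ℝ × ℝ) + x.2 • ((0, 1) : ℝ × ℝ) := by ext <;> simp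
      conv_lhs => rw [this, map_add, map_smul, map_smul]
      simp only [smul_eq_mul]
    -- The derivative of F(u, s) = (u, V(u, s)) is triangular with diagonal entries 1 and ∂V/∂s > 0,
    -- so it is inverted explicitly and the inverse function theorem applies.
    let e : (ℝ × ℝ) ≃L[ℝ] (ℝ × ℝ) := ContinuousLinearEquiv.equivOfInverse
      ((ContinuousLinearMap.fst ℝ ℝ ℝ).prod D)
      ((ContinuousLinearMap.fst ℝ ℝ ℝ).prod ((D (0, 1))⁻¹ •
        (ContinuousLinearMap.snd ℝ ℝ ℝ - D (1, 0) • ContinuousLinearMap.fst ℝ ℝ ℝ)))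
      (fun x => by
        ext
        · simp
        · simp [hlin x]
          field_simp
          ring)
      (fun x => by
        ext
        · simp
        · simp
          rw [hlin]
          field_simp
          ring)
    have hFe : HasFDerivAt F (e : ℝ × ℝ →L[ℝ] ℝ × ℝ) z := hFd z hzD
    have hstrict : HasStrictFDerivAt F (e : ℝ × ℝ →L[ℝ] ℝ × ℝ) z :=
      (hFc z hzD).hasStrictFDerivAt' hFe (by simp)
    have hFz : F z = y := hFG y
    have hloc : ContDiffAt ℝ ∞ ((hFc z hzD).localInverse hFe (by simp)) (F z) :=
      (hFc z hzD).to_localInverse hFe (by simp)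
    rw [hFz] at hloc
    refine hloc.congr_of_eventuallyEq ?_
    have h1 : ∀ᶠ x in 𝓝 (F z), F ((hFc z hzD).localInverse hFe (by simp) x) = x :=
      hstrict.eventually_right_inverse
    have h2 : ∀ᶠ x in 𝓝 y, ((hFc z hzD).localInverse hFe (by simp) x).2 ∈ Set.Ioo a b := by
      have h3 : (hFc z hzD).localInverse hFe (by simp) y = z := by
        rw [← hFz]
        exact (hFc z hzD).localInverse_apply_image hFe (by simp)
      refine hloc.continuousAt.eventually_mem (hopen.mem_nhds ?_)
      rw [h3]
      exact hzD
    rw [hFz] at h1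
    -- Near `y` the local inverse takes values in the strip, where `F` is injective, so it coincides
    -- with `G`.
    filter_upwards [h1, h2] with x hx1 hx2
    have hx1 := hx1.trans (hFG x).symm
    have e1 := congrArg Prod.fst hx1
    have e2 := congrArg Prod.snd hx1
    exact (hinj _ (G x) hx2 (hS _ _) e1 e2).symm
  refine ⟨G, hGsmooth, fun y => ⟨hS _ _, rfl, hVS _ _⟩, hGF, fun z X hz => ?_⟩
  have h1 : HasFDerivAt G (fderiv ℝ G (F z)) (F z) :=
    (hGsmooth.differentiable (by simp) _).hasFDerivAt
  have h2 := (h1.comp z (hFd z hz)).congr_of_eventuallyEq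
    (f₁ := id) (by
      filter_upwards [hopen.mem_nhds hz] with x hx
      exact (hGF x hx).symm)
  exact congrArg (fun g : ℝ × ℝ →L[ℝ] ℝ × ℝ => g X) (h2.unique (hasFDerivAt_id z))

end SuperLinear

/-! ### A smooth step function and its lift to the universal cover of the hyperboloid -/

namespace SuperLinear

/-- A smooth even bump function, positive exactly on `(-1/2, 1/2)`. -/
noncomputable def bump (q : ℝ) : ℝ := expNegInvGlue (1 / 4 - q ^ 2)

theorem contDiff_bump : ContDiff ℝ ∞ bump :=
  expNegInvGlue.contDiff.comp (contDiff_const.sub (contDiff_id.pow 2))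

theorem bump_nonneg (q : ℝ) : 0 ≤ bump q := expNegInvGlue.nonneg _

theorem bump_neg (q : ℝ) : bump (-q) = bump q := by simp [bump]

theorem bump_pos {q : ℝ} (h1 : -(1 / 2) < q) (h2 : q < 1 / 2) : 0 < bump q :=
  expNegInvGlue.pos_of_pos (by nlinarith)

theorem bump_eq_zero {q : ℝ} (h : 1 / 2 ≤ q) : bump q = 0 :=
  expNegInvGlue.zero_of_nonpos (by nlinarith)

/-- The odd primitive of `bump`. -/
noncomputable def step (q : ℝ) : ℝ := ∫ t in (0 : ℝ)..q, bump t

theorem hasDerivAt_step (q : ℝ) : HasDerivAt step (bump q) q :=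
  intervalIntegral.integral_hasDerivAt_right (contDiff_bump.continuous.intervalIntegrable _ _)
    (contDiff_bump.continuous.stronglyMeasurableAtFilter _ _) contDiff_bump.continuous.continuousAt

theorem contDiff_step : ContDiff ℝ ∞ step := by
  rw [contDiff_infty_iff_deriv]
  refine ⟨fun q => (hasDerivAt_step q).differentiableAt, ?_⟩
  rw [show deriv step = bump from funext fun q => (hasDerivAt_step q).deriv]
  exact contDiff_bump

theorem step_zero : step 0 = 0 := by simp [step]

theorem step_neg (q : ℝ) : step (-q) = -step q := by
  have h := intervalIntegral.integral_comp_neg (a := 0) (b := q) bump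
  simp only [bump_neg, neg_zero] at h
  rw [step, intervalIntegral.integral_symm, ← h, step]

theorem monotone_step : Monotone step :=
  monotone_of_deriv_nonneg (fun q => (hasDerivAt_step q).differentiableAt) fun q => by
    rw [(hasDerivAt_step q).deriv]
    exact bump_nonneg q

theorem step_pos {q : ℝ} (hq : 0 < q) : 0 < step q := by
  -- `bump` is positive only below 1/2, so the integral is cut off there and monotonicity does the
  -- rest.
  have hm : 0 < min q (1 / 2) := lt_min hq (by norm_num)
  refine lt_of_lt_of_le ?_ (monotone_step (min_le_left q (1 / 2)))
  refine intervalIntegral.intervalIntegral_pos_of_pos_on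
    (contDiff_bump.continuous.intervalIntegrable _ _) (fun x hx => ?_) hm
  exact bump_pos (by linarith [hx.1]) (hx.2.trans_le (min_le_right _ _))

theorem step_eq {q : ℝ} (hq : 1 / 2 ≤ q) : step q = step (1 / 2) := by
  have h : step q - step (1 / 2) = ∫ t in (1 / 2 : ℝ)..q, bump t :=
    intervalIntegral.integral_interval_sub_left
      (contDiff_bump.continuous.intervalIntegrable _ _)
      (contDiff_bump.continuous.intervalIntegrable _ _)
  have h2 : ∫ t in (1 / 2 : ℝ)..q, bump t = 0 := by
    rw [intervalIntegral.integral_congr (g := fun _ => (0 : ℝ))]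
    · simp
    · intro x hx
      rw [Set.uIcc_of_le hq] at hx
      exact bump_eq_zero hx.1
  linarith

theorem step_le (q : ℝ) : step q ≤ step (1 / 2) := by
  rcases le_total q (1 / 2) with h | h
  · exact monotone_step h
  · exact (step_eq h).le

theorem abs_step_le (q : ℝ) : |step q| ≤ step (1 / 2) :=
  abs_le.2 ⟨by have := step_le (-q); rw [step_neg] at this; linarith, step_le q⟩

theorem step_mul_self_pos {q : ℝ} (hq : q ≠ 0) : 0 < step q * q := by
  rcases hq.lt_or_gt with h | h
  · have := step_pos (neg_pos.2 h)
    rw [step_neg] at this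
    nlinarith
  · exact mul_pos (step_pos h) h

/-! ### The hyperboloid w² + q² = 1 + u² in the coordinates (u, s) -/

/-- The radius `√(1 + u²)` of the hyperboloid `w² + q² = 1 + u²` at height `u`. -/
noncomputable def radius (u : ℝ) : ℝ := √(1 + u ^ 2)

theorem radius_sq (u : ℝ) : radius u ^ 2 = 1 + u ^ 2 := Real.sq_sqrt (by positivity)

theorem one_le_radius (u : ℝ) : 1 ≤ radius u := Real.one_le_sqrt.2 (by nlinarith [sq_nonneg u])

theorem radius_pos (u : ℝ) : 0 < radius u := one_pos.trans_le (one_le_radius u)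

theorem radius_le (u : ℝ) : radius u ≤ 1 + u ^ 2 / 2 := by
  have h := radius_sq u
  nlinarith [sq_nonneg (u ^ 2), sq_nonneg u, radius_pos u]

theorem hasDerivAt_radius (u : ℝ) : HasDerivAt radius (u / radius u) u := by
  have h : HasDerivAt (fun u : ℝ => 1 + u ^ 2) (2 * u) u := by
    simpa using (hasDerivAt_pow 2 u).const_add 1
  refine (h.sqrt (by positivity)).congr_deriv ?_
  rw [radius]
  ring

theorem contDiff_radius : ContDiff ℝ ∞ radius :=
  (contDiff_const.add (contDiff_id.pow 2)).sqrt fun u => by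
    simp only [id]
    positivity

/-- The coordinate `w = √(1 + u²) cos s`. -/
noncomputable def cosCoord (z : ℝ × ℝ) : ℝ := radius z.1 * Real.cos z.2

/-- The first integral `q = √(1 + u²) sin s`. -/
noncomputable def sinCoord (z : ℝ × ℝ) : ℝ := radius z.1 * Real.sin z.2

/-- The lift of the boost of the hyperboloid to its universal cover. -/
noncomputable def boost (z : ℝ × ℝ) : ℝ × ℝ := (cosCoord z, -(z.1 * Real.sin z.2 / radius z.1))

theorem contDiff_cosCoord : ContDiff ℝ ∞ cosCoord :=
  (contDiff_radius.comp contDiff_fst).mul (Real.contDiff_cos.comp contDiff_snd)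

theorem contDiff_sinCoord : ContDiff ℝ ∞ sinCoord :=
  (contDiff_radius.comp contDiff_fst).mul (Real.contDiff_sin.comp contDiff_snd)

theorem fderiv_cosCoord (z x : ℝ × ℝ) : fderiv ℝ cosCoord z x =
    z.1 / radius z.1 * Real.cos z.2 * x.1 - sinCoord z * x.2 := by
  have h := ((hasDerivAt_radius z.1).comp_hasFDerivAt z hasFDerivAt_fst).mul
    ((Real.hasDerivAt_cos z.2).comp_hasFDerivAt z (hasFDerivAt_snd (𝕜 := ℝ) (E := ℝ) (F := ℝ) (p := z)))
  have h' : HasFDerivAt cosCoord _ z := h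
  rw [h'.fderiv]
  simp [sinCoord]
  ring

theorem fderiv_sinCoord (z x : ℝ × ℝ) : fderiv ℝ sinCoord z x =
    z.1 / radius z.1 * Real.sin z.2 * x.1 + cosCoord z * x.2 := by
  have h := ((hasDerivAt_radius z.1).comp_hasFDerivAt z hasFDerivAt_fst).mul
    ((Real.hasDerivAt_sin z.2).comp_hasFDerivAt z (hasFDerivAt_snd (𝕜 := ℝ) (E := ℝ) (F := ℝ) (p := z)))
  have h' : HasFDerivAt sinCoord _ z := h
  rw [h'.fderiv]
  simp [cosCoord]
  ring

theorem fderiv_cosCoord_boost (z : ℝ × ℝ) : fderiv ℝ cosCoord z (boost z) = z.1 := by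
  have h := (radius_pos z.1).ne'
  rw [fderiv_cosCoord, boost, cosCoord, sinCoord]
  field_simp
  linear_combination z.1 * Real.sin_sq_add_cos_sq z.2

theorem fderiv_sinCoord_boost (z : ℝ × ℝ) : fderiv ℝ sinCoord z (boost z) = 0 := by
  have h := (radius_pos z.1).ne'
  rw [fderiv_sinCoord, boost, cosCoord]
  field_simp
  ring

theorem hasFDerivAt_step_sinCoord (z : ℝ × ℝ) : HasFDerivAt (fun z => step (sinCoord z))
    (bump (sinCoord z) • fderiv ℝ sinCoord z) z :=
  (hasDerivAt_step _).comp_hasFDerivAt z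
    (contDiff_sinCoord.differentiable (by simp) z).hasFDerivAt

/-! ### A single smooth step across s = 0 that is a first integral -/

/-- The function which equals `step (√(1 + u²) sin s)` on the strip `|s| ≤ π / 2` and is extended
by constants to the plane. -/
noncomputable def transition (z : ℝ × ℝ) : ℝ :=
  step (radius z.1 * Real.sin (max (-(Real.pi / 2)) (min (Real.pi / 2) z.2)))

theorem transition_of_mem {z : ℝ × ℝ} (h1 : -(Real.pi / 2) ≤ z.2) (h2 : z.2 ≤ Real.pi / 2) :
    transition z = step (sinCoord z) := by
  rw [transition, min_eq_right h2, max_eq_right h1, sinCoord]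

theorem transition_of_ge {z : ℝ × ℝ} (h : Real.pi / 6 ≤ z.2) : transition z = step (1 / 2) := by
  have hpi := Real.pi_pos
  refine step_eq ?_
  have h1 : 1 / 2 ≤ Real.sin (max (-(Real.pi / 2)) (min (Real.pi / 2) z.2)) := by
    rw [← Real.sin_pi_div_six]
    refine Real.sin_le_sin_of_le_of_le_pi_div_two (by linarith) ?_ ?_
    · exact max_le (by linarith) (min_le_left _ _)
    · exact le_max_of_le_right (le_min (by linarith) h)
  nlinarith [one_le_radius z.1]

theorem transition_neg (u s : ℝ) : transition (u, -s) = -transition (u, s) := by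
  have h : max (-(Real.pi / 2)) (min (Real.pi / 2) (-s)) =
      -max (-(Real.pi / 2)) (min (Real.pi / 2) s) := by
    have := Real.pi_pos
    grind
  simp only [transition]
  rw [h, Real.sin_neg, mul_neg, step_neg]

theorem transition_of_le {z : ℝ × ℝ} (h : z.2 ≤ -(Real.pi / 6)) :
    transition z = -step (1 / 2) := by
  have h1 := transition_neg z.1 (-z.2)
  rw [neg_neg] at h1
  rw [show z = (z.1, z.2) from rfl, h1, transition_of_ge (by simp only; linarith)]

theorem abs_transition_le (z : ℝ × ℝ) : |transition z| ≤ step (1 / 2) := abs_step_le _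

theorem transition_pos {z : ℝ × ℝ} (h : 0 < z.2) : 0 < transition z := by
  have hpi := Real.pi_pos
  rcases le_total z.2 (Real.pi / 2) with h2 | h2
  · rw [transition_of_mem (by linarith) h2]
    exact step_pos (mul_pos (radius_pos _) (Real.sin_pos_of_pos_of_lt_pi h (by linarith)))
  · rw [transition_of_ge (by linarith)]
    exact step_pos (by norm_num)

/-- For π/6 ≤ |s| ≤ π/2 one has |q| ≥ 1/2, where `step` is already constant; the two descriptions
therefore overlap on open sets, and smoothness and derivatives can be checked locally. -/
theorem transition_eventuallyEq (z : ℝ × ℝ) :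
    (|z.2| < Real.pi / 2 ∧ transition =ᶠ[𝓝 z] fun z => step (sinCoord z)) ∨
      (Real.pi / 2 ≤ |z.2| ∧ ∃ c : ℝ, transition =ᶠ[𝓝 z] fun _ => c) := by
  have hpi := Real.pi_pos
  rcases lt_or_ge |z.2| (Real.pi / 2) with h | h
  · refine Or.inl ⟨h, ?_⟩
    filter_upwards [(isOpen_lt (continuous_abs.comp continuous_snd) continuous_const).mem_nhds h]
      with x hx
    exact transition_of_mem (abs_lt.1 hx).1.le (abs_lt.1 hx).2.le
  · refine Or.inr ⟨h, ?_⟩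
    rcases le_abs.1 h with h | h
    · refine ⟨step (1 / 2), ?_⟩
      filter_upwards [(isOpen_lt continuous_const continuous_snd).mem_nhds
        (show Real.pi / 6 < z.2 by linarith)] with x hx
      exact transition_of_ge (le_of_lt hx)
    · refine ⟨-step (1 / 2), ?_⟩
      filter_upwards [(isOpen_lt continuous_snd continuous_const).mem_nhds
        (show z.2 < -(Real.pi / 6) by linarith)] with x hx
      exact transition_of_le (le_of_lt hx)

theorem contDiff_transition : ContDiff ℝ ∞ transition := by
  rw [contDiff_iff_contDiffAt]
  intro z
  rcases transition_eventuallyEq z with ⟨_, h⟩ | ⟨_, c, h⟩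
  · exact (contDiff_step.comp contDiff_sinCoord).contDiffAt.congr_of_eventuallyEq h
  · exact contDiffAt_const.congr_of_eventuallyEq h

theorem fderiv_transition_boost (z : ℝ × ℝ) : fderiv ℝ transition z (boost z) = 0 := by
  rcases transition_eventuallyEq z with ⟨_, h⟩ | ⟨_, c, h⟩
  · rw [h.fderiv_eq, (hasFDerivAt_step_sinCoord z).fderiv]
    simp [fderiv_sinCoord_boost]
  · rw [h.fderiv_eq]
    simp

theorem fderiv_transition_snd {z : ℝ × ℝ} (hz : |z.2| ≤ Real.pi / 2) :
    fderiv ℝ transition z (0, 1) = bump (sinCoord z) * cosCoord z := by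
  rcases transition_eventuallyEq z with ⟨_, h⟩ | ⟨h', c, h⟩
  · rw [h.fderiv_eq, (hasFDerivAt_step_sinCoord z).fderiv]
    simp [fderiv_sinCoord]
  · rw [h.fderiv_eq]
    -- Only |s| = π/2 remains here; both sides vanish, the left by local constancy and the right
    -- because of the cosine.
    have : Real.cos z.2 = 0 := by
      rw [← Real.cos_abs, le_antisymm hz h', Real.cos_pi_div_two]
    simp [cosCoord, this]

theorem fderiv_transition_snd_nonneg (z : ℝ × ℝ) : 0 ≤ fderiv ℝ transition z (0, 1) := by
  rcases le_total |z.2| (Real.pi / 2) with h | h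
  · rw [fderiv_transition_snd h]
    exact mul_nonneg (bump_nonneg _) (mul_nonneg (radius_pos _).le
      (Real.cos_nonneg_of_mem_Icc (abs_le.1 h)))
  · rcases transition_eventuallyEq z with ⟨h', _⟩ | ⟨_, c, h'⟩
    · exact absurd h h'.not_ge
    · rw [h'.fderiv_eq]
      simp

end SuperLinear

/-! ### The chart of the universal cover in which the state is linearizable -/

namespace SuperLinear

/-- Translation by nπ preserves the boost up to sign, so translates of first integrals are first
integrals. The reflection below plays the same role for the second logarithm in `chart`. -/
theorem boost_sub_nat_mul_pi (z : ℝ × ℝ) (n : ℕ) :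
    boost (z.1, z.2 - n * Real.pi) = (-1 : ℝ) ^ n • boost z := by
  simp only [boost, cosCoord, Real.sin_sub_nat_mul_pi, Real.cos_sub_nat_mul_pi, Prod.smul_mk,
    smul_eq_mul]
  ext <;> ring

theorem boost_nat_mul_pi_sub (z : ℝ × ℝ) (n : ℕ) :
    boost (z.1, n * Real.pi - z.2) =
      (-1 : ℝ) ^ n • ((boost z).1, -(boost z).2) := by
  simp only [boost, cosCoord, Real.sin_nat_mul_pi_sub, Real.cos_nat_mul_pi_sub, Prod.smul_mk,
    smul_eq_mul]
  ext <;> ring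

theorem hasFDerivAt_transition_sub (c : ℝ) (z : ℝ × ℝ) :
    HasFDerivAt (fun z : ℝ × ℝ => transition (z.1, z.2 - c))
      (fderiv ℝ transition (z.1, z.2 - c)) z := by
  have h := (contDiff_transition.differentiable (by simp) (z.1, z.2 - c)).hasFDerivAt
  have h2 : HasFDerivAt (fun z : ℝ × ℝ => (z.1, z.2 - c))
      ((ContinuousLinearMap.fst ℝ ℝ ℝ).prod (ContinuousLinearMap.snd ℝ ℝ ℝ)) z :=
    hasFDerivAt_fst.prodMk (hasFDerivAt_snd.sub_const c)
  exact HasFDerivAt.comp z h h2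

theorem hasFDerivAt_transition_rev (c : ℝ) (z : ℝ × ℝ) :
    HasFDerivAt (fun z : ℝ × ℝ => transition (z.1, c - z.2))
      ((fderiv ℝ transition (z.1, c - z.2)).comp
        ((ContinuousLinearMap.fst ℝ ℝ ℝ).prod (-ContinuousLinearMap.snd ℝ ℝ ℝ))) z := by
  have h := (contDiff_transition.differentiable (by simp) (z.1, c - z.2)).hasFDerivAt
  have h2 : HasFDerivAt (fun z : ℝ × ℝ => (z.1, c - z.2))
      ((ContinuousLinearMap.fst ℝ ℝ ℝ).prod (-ContinuousLinearMap.snd ℝ ℝ ℝ)) z :=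
    hasFDerivAt_fst.prodMk (hasFDerivAt_snd.const_sub c)
  exact HasFDerivAt.comp z h h2

/-! ### First integrals and the coordinate v on the strip -/

/-- The first integral which increases from strip to strip. -/
noncomputable def staircase (l : ℕ) (z : ℝ × ℝ) : ℝ :=
  ∑ n ∈ Finset.range (l + 1), transition (z.1, z.2 - n * Real.pi)

theorem hasFDerivAt_staircase (l : ℕ) (z : ℝ × ℝ) :
    HasFDerivAt (staircase l)
      (∑ n ∈ Finset.range (l + 1), fderiv ℝ transition (z.1, z.2 - n * Real.pi)) z :=
  HasFDerivAt.fun_sum fun n _ => hasFDerivAt_transition_sub (n * Real.pi) z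

theorem contDiff_staircase (l : ℕ) : ContDiff ℝ ∞ (staircase l) :=
  ContDiff.sum fun _ _ => contDiff_transition.comp
    (contDiff_fst.prodMk (contDiff_snd.sub contDiff_const))

theorem fderiv_staircase_boost (l : ℕ) (z : ℝ × ℝ) : fderiv ℝ (staircase l) z (boost z) = 0 := by
  rw [(hasFDerivAt_staircase l z).fderiv, sum_apply]
  refine Finset.sum_eq_zero fun n _ => ?_
  have h := fderiv_transition_boost (z.1, z.2 - n * Real.pi)
  rw [boost_sub_nat_mul_pi, map_smul] at h
  exact (smul_eq_zero.1 h).resolve_left (by simp)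

theorem abs_staircase_le (l : ℕ) (z : ℝ × ℝ) : |staircase l z| ≤ (l + 1) * step (1 / 2) := by
  refine (Finset.abs_sum_le_sum_abs _ _).trans ?_
  refine (Finset.sum_le_card_nsmul _ _ (step (1 / 2)) fun n _ => abs_transition_le _).trans ?_
  simp

/-- The s-derivative of step(q) is bump(q) w, which changes sign with w. Summing translated steps,
all increasing in s, replaces w by |w|; this is what makes `chart` monotone. -/
theorem le_fderiv_staircase_snd {l : ℕ} {z : ℝ × ℝ} (hz : z.2 ∈ Set.Ioo 0 (l * Real.pi)) :
    bump (sinCoord z) * |cosCoord z| ≤ fderiv ℝ (staircase l) z (0, 1) := by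
  have hpi := Real.pi_pos
  -- The multiple of π nearest to s. It is at most l, possibly l itself, which is why the staircase
  -- has l + 1 terms.
  set m := ⌊z.2 / Real.pi + 1 / 2⌋₊ with hm
  have h0 : 0 ≤ z.2 / Real.pi + 1 / 2 := by have := hz.1; positivity
  have hle : (m : ℝ) ≤ z.2 / Real.pi + 1 / 2 := Nat.floor_le h0
  have hlt : z.2 / Real.pi + 1 / 2 < m + 1 := Nat.lt_floor_add_one _
  have hdiv : z.2 / Real.pi < l := (div_lt_iff₀ hpi).2 hz.2
  have hml : m < l + 1 := by
    have : (m : ℝ) < l + 1 := by linarith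
    exact_mod_cast this
  have habs : |z.2 - m * Real.pi| ≤ Real.pi / 2 := by
    have hzd : z.2 = z.2 / Real.pi * Real.pi := by field_simp
    rw [abs_le]
    constructor
    · rw [hzd]; nlinarith
    · rw [hzd]; nlinarith
  have hterm : bump (sinCoord z) * |cosCoord z| =
      fderiv ℝ transition (z.1, z.2 - m * Real.pi) (0, 1) := by
    rw [fderiv_transition_snd habs]
    have hc : 0 ≤ cosCoord (z.1, z.2 - m * Real.pi) := mul_nonneg (radius_pos _).le
      (Real.cos_nonneg_of_mem_Icc (abs_le.1 habs))
    -- The translation may flip the signs of q and w; `bump` is even and w enters through its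
    -- absolute value.
    have hs : bump (sinCoord (z.1, z.2 - m * Real.pi)) = bump (sinCoord z) := by
      simp only [sinCoord, Real.sin_sub_nat_mul_pi]
      rcases neg_one_pow_eq_or ℝ m with h | h <;> simp [h, bump_neg]
    have hcos : |cosCoord z| = |cosCoord (z.1, z.2 - m * Real.pi)| := by
      simp only [cosCoord, Real.cos_sub_nat_mul_pi]
      rcases neg_one_pow_eq_or ℝ m with h | h <;> simp [h]
    rw [hs, hcos, abs_of_nonneg hc]
  rw [hterm, (hasFDerivAt_staircase l z).fderiv, sum_apply]
  exact Finset.single_le_sum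
    (f := fun n : ℕ => fderiv ℝ transition (z.1, z.2 - n * Real.pi) (0, 1))
    (fun n _ => fderiv_transition_snd_nonneg _) (Finset.mem_range.2 hml)

/-- The second coordinate of the chart. -/
noncomputable def chart (l : ℕ) (z : ℝ × ℝ) : ℝ :=
  (2 + z.1 ^ 2 / 2) * staircase l z - step (sinCoord z) * cosCoord z +
    Real.log (transition z) - Real.log (transition (z.1, l * Real.pi - z.2))

theorem transition_ne_zero_of_mem {l : ℕ} {z : ℝ × ℝ} (hz : z.2 ∈ Set.Ioo 0 (l * Real.pi)) :
    transition z ≠ 0 ∧ transition (z.1, l * Real.pi - z.2) ≠ 0 :=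
  ⟨(transition_pos hz.1).ne', (transition_pos (z := (z.1, l * Real.pi - z.2))
    (sub_pos.2 hz.2)).ne'⟩

theorem contDiffAt_chart {l : ℕ} {z : ℝ × ℝ} (hz : z.2 ∈ Set.Ioo 0 (l * Real.pi)) :
    ContDiffAt ℝ ∞ (chart l) z := by
  obtain ⟨h1, h2⟩ := transition_ne_zero_of_mem hz
  have hrev : ContDiff ℝ ∞ fun z : ℝ × ℝ => transition (z.1, l * Real.pi - z.2) :=
    contDiff_transition.comp (contDiff_fst.prodMk (contDiff_const.sub contDiff_snd))
  have hq : ContDiff ℝ ∞ fun z : ℝ × ℝ => 2 + z.1 ^ 2 / 2 := by fun_prop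
  exact (((hq.mul (contDiff_staircase l)).sub ((contDiff_step.comp contDiff_sinCoord).mul
    contDiff_cosCoord)).contDiffAt.add (contDiff_transition.contDiffAt.log h1)).sub
    (hrev.contDiffAt.log h2)

theorem fderiv_chart {l : ℕ} {z : ℝ × ℝ} (hz : z.2 ∈ Set.Ioo 0 (l * Real.pi)) (x : ℝ × ℝ) :
    fderiv ℝ (chart l) z x =
    (2 + z.1 ^ 2 / 2) * fderiv ℝ (staircase l) z x + staircase l z * (z.1 * x.1) -
      (step (sinCoord z) * fderiv ℝ cosCoord z x +
        cosCoord z * (bump (sinCoord z) * fderiv ℝ sinCoord z x)) +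
      fderiv ℝ transition z x / transition z -
      fderiv ℝ transition (z.1, l * Real.pi - z.2) (x.1, -x.2) /
        transition (z.1, l * Real.pi - z.2) := by
  obtain ⟨h1, h2⟩ := transition_ne_zero_of_mem hz
  have hE := ((contDiff_staircase l).differentiable (by simp) z).hasFDerivAt
  have hw := (contDiff_cosCoord.differentiable (by simp) z).hasFDerivAt
  have hp := ((contDiff_transition.differentiable (by simp) z).hasFDerivAt).log h1
  have hq := (hasFDerivAt_transition_rev (l * Real.pi) z).log h2
  have hu : HasFDerivAt (fun z : ℝ × ℝ => 2 + z.1 ^ 2 / 2)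
      (z.1 • ContinuousLinearMap.fst ℝ ℝ ℝ) z := by
    have h : HasDerivAt (fun u : ℝ => 2 + u ^ 2 / 2) z.1 z.1 := by
      refine (((hasDerivAt_pow 2 z.1).div_const 2).const_add 2).congr_deriv ?_
      norm_num
    exact h.comp_hasFDerivAt z hasFDerivAt_fst
  have h : HasFDerivAt (chart l) _ z :=
    (((hu.mul hE).sub ((hasFDerivAt_step_sinCoord z).mul hw)).add hp).sub hq
  rw [h.fderiv]
  simp
  ring

/-- The staircase E, step(q) and both logarithms are first integrals. Only (u²/2)' = uw and w' = u
contribute, giving E u w - step(q) u. -/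
theorem fderiv_chart_boost {l : ℕ} {z : ℝ × ℝ} (hz : z.2 ∈ Set.Ioo 0 (l * Real.pi)) :
    fderiv ℝ (chart l) z (boost z) =
    -step (sinCoord z) * z.1 + 2 * (staircase l z / 2 * z.1 * cosCoord z) := by
  have hrev : fderiv ℝ transition (z.1, l * Real.pi - z.2) ((boost z).1, -(boost z).2) = 0 := by
    have h := fderiv_transition_boost (z.1, l * Real.pi - z.2)
    rw [boost_nat_mul_pi_sub, map_smul] at h
    exact (smul_eq_zero.1 h).resolve_left (by simp)
  rw [fderiv_chart hz, hrev, fderiv_staircase_boost, fderiv_cosCoord_boost, fderiv_sinCoord_boost,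
    fderiv_transition_boost]
  simp only [boost]
  ring

/-- With ∂w/∂s = -q and ∂q/∂s = w, the derivative is (2 + u²/2) ∂E/∂s + step(q) q - bump(q) w² plus
nonnegative logarithmic terms. As ∂E/∂s ≥ bump(q)|w| and |w| ≤ 1 + u²/2, it is at least bump(q)|w| +
step(q) q. This is positive: for q ≠ 0 by the second term, for q = 0 by the first, since then w² = 1
+ u². -/
theorem fderiv_chart_snd_pos {l : ℕ} {z : ℝ × ℝ} (hz : z.2 ∈ Set.Ioo 0 (l * Real.pi)) :
    0 < fderiv ℝ (chart l) z (0, 1) := by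
  have hp : 0 ≤ fderiv ℝ transition z (0, 1) / transition z :=
    div_nonneg (fderiv_transition_snd_nonneg z) (transition_pos hz.1).le
  have hq : fderiv ℝ transition (z.1, l * Real.pi - z.2) (0, -1) /
      transition (z.1, l * Real.pi - z.2) ≤ 0 := by
    refine div_nonpos_of_nonpos_of_nonneg ?_ (transition_pos
      (z := (z.1, l * Real.pi - z.2)) (sub_pos.2 hz.2)).le
    rw [show ((0, -1) : ℝ × ℝ) = -(0, 1) by simp, map_neg]
    exact neg_nonpos.2 (fderiv_transition_snd_nonneg _)
  have hE := le_fderiv_staircase_snd hz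
  have hsq : sinCoord z ^ 2 + cosCoord z ^ 2 = radius z.1 ^ 2 := by
    rw [sinCoord, cosCoord]
    linear_combination radius z.1 ^ 2 * Real.sin_sq_add_cos_sq z.2
  have hR := radius_pos z.1
  have hw : |cosCoord z| ≤ radius z.1 := abs_le_of_sq_le_sq (by nlinarith [sq_nonneg (sinCoord z)])
    hR.le
  have hR' := radius_le z.1
  have hb := bump_nonneg (sinCoord z)
  have hmain : 0 < bump (sinCoord z) * |cosCoord z| + step (sinCoord z) * sinCoord z := by
    by_cases hq0 : sinCoord z = 0
    · rw [hq0, step_zero, zero_mul, add_zero]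
      refine mul_pos (bump_pos (by norm_num) (by norm_num)) (abs_pos.2 fun h => ?_)
      rw [hq0, h] at hsq
      nlinarith
    · exact add_pos_of_nonneg_of_pos (mul_nonneg hb (abs_nonneg _)) (step_mul_self_pos hq0)
  have h1 : (2 + z.1 ^ 2 / 2) * (bump (sinCoord z) * |cosCoord z|) ≤
      (2 + z.1 ^ 2 / 2) * fderiv ℝ (staircase l) z (0, 1) :=
    mul_le_mul_of_nonneg_left hE (by positivity)
  have h2 : bump (sinCoord z) * |cosCoord z| * |cosCoord z| ≤
      bump (sinCoord z) * |cosCoord z| * (1 + z.1 ^ 2 / 2) :=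
    mul_le_mul_of_nonneg_left (hw.trans hR') (mul_nonneg hb (abs_nonneg _))
  have h3 : |cosCoord z| * |cosCoord z| = cosCoord z * cosCoord z := abs_mul_abs_self _
  rw [fderiv_chart hz, fderiv_cosCoord, fderiv_sinCoord]
  simp only [mul_zero, mul_one, zero_sub, zero_add, add_zero]
  have h4 : bump (sinCoord z) * |cosCoord z| * |cosCoord z| =
      cosCoord z * (bump (sinCoord z) * cosCoord z) := by
    rw [mul_assoc, h3]; ring
  nlinarith

/-- Without its logarithmic terms, `chart` is bounded on each fibre. -/
theorem abs_chart_sub_log_le (l : ℕ) (z : ℝ × ℝ) :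
    |chart l z - (Real.log (transition z) - Real.log (transition (z.1, l * Real.pi - z.2)))| ≤
      (2 + z.1 ^ 2 / 2) * ((l + 1) * step (1 / 2)) + step (1 / 2) * radius z.1 := by
  have h1 : |(2 + z.1 ^ 2 / 2) * staircase l z| ≤
      (2 + z.1 ^ 2 / 2) * ((l + 1) * step (1 / 2)) := by
    rw [abs_mul, abs_of_nonneg (by positivity : (0 : ℝ) ≤ 2 + z.1 ^ 2 / 2)]
    exact mul_le_mul_of_nonneg_left (abs_staircase_le l z) (by positivity)
  have h2 : |step (sinCoord z) * cosCoord z| ≤ step (1 / 2) * radius z.1 := by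
    rw [abs_mul]
    refine mul_le_mul (abs_step_le _) ?_ (abs_nonneg _) (step_pos (by norm_num)).le
    rw [cosCoord, abs_mul, abs_of_pos (radius_pos _)]
    exact mul_le_of_le_one_right (radius_pos _).le (Real.abs_cos_le_one _)
  have h3 := abs_sub ((2 + z.1 ^ 2 / 2) * staircase l z) (step (sinCoord z) * cosCoord z)
  rw [chart]
  ring_nf at *
  linarith

theorem exists_transition_lt (u : ℝ) {ε : ℝ} (hε : 0 < ε) :
    ∃ s ∈ Set.Ioo 0 (Real.pi / 2), transition (u, s) < ε := by
  have hpi := Real.pi_pos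
  have hc : ContinuousAt (fun s => transition (u, s)) 0 :=
    (contDiff_transition.continuous.comp (Continuous.prodMk_right u)).continuousAt
  have h0 : transition (u, 0) < ε := by
    rw [transition_of_mem (by simp only; linarith) (by simp only; linarith)]
    simpa [sinCoord, step_zero] using hε
  have hev : ∀ᶠ s in 𝓝[>] (0 : ℝ), transition (u, s) < ε :=
    (hc.eventually (gt_mem_nhds h0)).filter_mono nhdsWithin_le_nhds
  have hI : ∀ᶠ s in 𝓝[>] (0 : ℝ), s ∈ Set.Ioo 0 (Real.pi / 2) :=
    Ioo_mem_nhdsGT (by positivity)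
  obtain ⟨s, h1, h2⟩ := (hev.and hI).exists
  exact ⟨s, h2, h1⟩

/-- The logarithms drive `chart` to -∞ as s → 0 and to +∞ as s → lπ, while its other terms stay
bounded on the fibre; the intermediate value theorem concludes. -/
theorem exists_chart_eq {l : ℕ} (hl : l ≠ 0) (u v : ℝ) :
    ∃ s ∈ Set.Ioo 0 (l * Real.pi), chart l (u, s) = v := by
  have hpi := Real.pi_pos
  have hl1 : Real.pi ≤ l * Real.pi := by
    have : (1 : ℝ) ≤ l := by exact_mod_cast Nat.one_le_iff_ne_zero.2 hl
    nlinarith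
  set C := (2 + u ^ 2 / 2) * ((l + 1) * step (1 / 2)) + step (1 / 2) * radius u with hC
  have hbound : ∀ s, |chart l (u, s) - (Real.log (transition (u, s)) -
    Real.log (transition (u, l * Real.pi - s)))| ≤ C := fun s => abs_chart_sub_log_le l (u, s)
  set K := Real.log (step (1 / 2)) with hK
  -- The exponent absorbs the bound C and the other logarithm, equal to K at both s and its mirror
  -- image lπ - s; this puts `chart` below v at s and above v at the mirror image.
  obtain ⟨s, hs, hlt⟩ := exists_transition_lt u (Real.exp_pos (-|v| - C - |K|))
  have hlog : Real.log (transition (u, s)) < -|v| - C - |K| := by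
    rw [← Real.log_exp (-|v| - C - |K|)]
    exact Real.log_lt_log (transition_pos hs.1) hlt
  have hend : transition (u, l * Real.pi - s) = step (1 / 2) :=
    transition_of_ge (by simp only; linarith [hs.2])
  have hlow : chart l (u, s) ≤ v := by
    have h := (abs_le.1 (hbound s)).2
    rw [hend] at h
    linarith [neg_abs_le v, neg_abs_le K]
  have hhigh : v ≤ chart l (u, l * Real.pi - s) := by
    have h := (abs_le.1 (hbound (l * Real.pi - s))).1
    rw [sub_sub_cancel, hend] at h
    linarith [le_abs_self v, neg_abs_le K]
  have hsub : Set.Icc s (l * Real.pi - s) ⊆ Set.Ioo 0 (l * Real.pi) := fun t ht =>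
    ⟨hs.1.trans_le ht.1, ht.2.trans_lt (by linarith [hs.1])⟩
  have hcont : ContinuousOn (fun t => chart l (u, t)) (Set.Icc s (l * Real.pi - s)) := by
    intro t ht
    exact (ContinuousAt.comp (f := fun t : ℝ => (u, t))
      (contDiffAt_chart (z := (u, t)) (hsub ht)).continuousAt
      (Continuous.prodMk_right u).continuousAt).continuousWithinAt
  obtain ⟨t, ht, hv⟩ := intermediate_value_Icc (by linarith [hs.2]) hcont ⟨hlow, hhigh⟩
  exact ⟨t, hsub ht, hv⟩

end SuperLinear

/-! ### Counting equilibria -/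

namespace SuperLinear

/-- There is a super-linearizable smooth flow without equilibria. -/
theorem exists_flow_encard_zero (d : ℕ) :
    ∃ Φ : Flow ℝ (Euc (d + 2)), IsSmoothFlow Φ ∧ IsSuperLinearizable Φ ∧
      {x | IsEquilibrium Φ x}.encard = 0 := by
  have hw : ContDiff ℝ ∞ fun z : ℝ × ℝ => radius z.1 := contDiff_radius.comp contDiff_fst
  obtain ⟨Φ, h1, h2, h3⟩ := exists_flow_of_planar d (β := fun _ => 0) (γ := fun _ => 0) hw
    contDiff_const contDiff_const (fun z => by
      have h : HasFDerivAt (fun z : ℝ × ℝ => radius z.1) _ z :=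
        (hasDerivAt_radius z.1).comp_hasFDerivAt z (hasFDerivAt_fst (𝕜 := ℝ) (E := ℝ) (F := ℝ) (p := z))
      rw [h.fderiv]
      have := (radius_pos z.1).ne'
      simp
      field_simp) (fun z => by simp) (fun z => by simp)
  refine ⟨Φ, h1, h2, Set.encard_eq_zero.2 (Set.eq_empty_of_forall_notMem fun x hx => ?_)⟩
  exact (radius_pos _).ne' ((h3 x).1 hx).2.1

/-- The zeros of the cosine in `(0, lπ)` are the points `π / 2 + jπ` with `j < l`. -/
theorem cos_eq_zero_iff_of_mem_Ioo {l : ℕ} {s : ℝ} (hs : s ∈ Set.Ioo 0 (l * Real.pi)) :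
    Real.cos s = 0 ↔ ∃ j : Fin l, s = Real.pi / 2 + j * Real.pi := by
  have hpi := Real.pi_pos
  rw [Real.cos_eq_zero_iff]
  constructor
  · rintro ⟨k, rfl⟩
    have h0 : (0 : ℝ) < 2 * k + 1 := by
      by_contra h
      have := hs.1
      nlinarith
    have h1 : (2 * k + 1 : ℝ) < 2 * l := by
      by_contra h
      have := hs.2
      nlinarith
    have h0' : 0 < 2 * k + 1 := by exact_mod_cast h0
    have h1' : 2 * k + 1 < 2 * l := by exact_mod_cast h1
    lift k to ℕ using by omega
    exact ⟨⟨k, by omega⟩, by push_cast; ring⟩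
  · rintro ⟨j, rfl⟩
    exact ⟨j, by push_cast; ring⟩

/-- For `l ≠ 0` there is a super-linearizable smooth flow with exactly `l` equilibria. -/
theorem exists_flow_encard_eq (d : ℕ) {l : ℕ} (hl : l ≠ 0) :
    ∃ Φ : Flow ℝ (Euc (d + 2)), IsSmoothFlow Φ ∧ IsSuperLinearizable Φ ∧
      {x | IsEquilibrium Φ x}.encard = l := by
  obtain ⟨G, hG, hGV, hVG, hdG⟩ := exists_contDiff_fibre_inverse (V := chart l)
    (fun z hz => contDiffAt_chart hz) (fun z hz => fderiv_chart_snd_pos hz) (exists_chart_eq hl)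
  -- `G` carries the planar field back to the boost, so derivatives of g ∘ G along the planar field
  -- are derivatives of g along the boost.
  have hinv : ∀ g : ℝ × ℝ → ℝ, ContDiff ℝ ∞ g → ∀ y,
      fderiv ℝ (fun y => g (G y)) y (cosCoord (G y), -step (sinCoord (G y)) * y.1 +
        2 * (staircase l (G y) / 2 * y.1 * cosCoord (G y))) = fderiv ℝ g (G y) (boost (G y)) := by
    intro g hg y
    obtain ⟨hmem, h1, h2⟩ := hGV y
    have hd := hdG (G y) (boost (G y)) hmem
    rw [fderiv_chart_boost hmem, h1, h2] at hd
    have hcomp : HasFDerivAt (fun y => g (G y)) ((fderiv ℝ g (G y)).comp (fderiv ℝ G y)) y :=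
      HasFDerivAt.comp y (hg.differentiable (by simp) _).hasFDerivAt
        (hG.differentiable (by simp) _).hasFDerivAt
    rw [hcomp.fderiv]
    exact congrArg (fderiv ℝ g (G y)) hd
  have hβ : ContDiff ℝ ∞ fun z => -step (sinCoord z) := (contDiff_step.comp contDiff_sinCoord).neg
  have hγ : ContDiff ℝ ∞ fun z => staircase l z / 2 := (contDiff_staircase l).div_const 2
  obtain ⟨Φ, hΦ1, hΦ2, hΦ3⟩ := exists_flow_of_planar d (contDiff_cosCoord.comp hG) (hβ.comp hG)
    (hγ.comp hG)
    (fun z => (hinv _ contDiff_cosCoord z).trans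
      ((fderiv_cosCoord_boost _).trans (hGV z).2.1))
    (fun z => (hinv _ hβ z).trans (by
      rw [(hasFDerivAt_step_sinCoord (G z)).fun_neg.fderiv]
      simp [fderiv_sinCoord_boost]))
    (fun z => (hinv _ hγ z).trans (by
      have h := (((contDiff_staircase l).differentiable (by simp) (G z)).hasFDerivAt.mul_const
        (2 : ℝ)⁻¹)
      simp only [← div_eq_mul_inv] at h
      rw [h.fderiv]
      simp [fderiv_staircase_boost]))
  refine ⟨Φ, hΦ1, hΦ2, ?_⟩
  have hpi := Real.pi_pos
  set s : Fin l → ℝ := fun j => Real.pi / 2 + j * Real.pi with hs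
  have hsmem : ∀ j, s j ∈ Set.Ioo 0 (l * Real.pi) := by
    intro j
    have hj : (j : ℝ) + 1 ≤ l := by exact_mod_cast j.2
    exact ⟨by positivity, by simp only [hs]; nlinarith⟩
  set e : Fin l → Euc (d + 2) := fun j =>
    WithLp.toLp 2 (Fin.cons 0 (Fin.cons (chart l (0, s j)) fun _ => 0)) with he
  have he0 : ∀ j, e j 0 = 0 := fun j => rfl
  have he1 : ∀ j, e j 1 = chart l (0, s j) := fun j => rfl
  have hinj : Function.Injective e := by
    intro i j hij
    -- Applying `G` recovers the angle `s j` from the second coordinate.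
    have h := congrArg (fun x : Euc (d + 2) => G (0, x 1)) hij
    simp only [he1] at h
    rw [hVG (0, s i) (hsmem i), hVG (0, s j) (hsmem j)] at h
    have h' : s i = s j := congrArg Prod.snd h
    simp only [hs, add_right_inj, mul_eq_mul_right_iff, hpi.ne', or_false, Nat.cast_inj] at h'
    exact Fin.ext h'
  have hrange : {x | IsEquilibrium Φ x} = Set.range e := by
    ext x
    rw [Set.mem_ofPred_eq, hΦ3]
    constructor
    · rintro ⟨h0, hw, hi⟩
      obtain ⟨hmem, h1, h2⟩ := hGV (x 0, x 1)
      have hcos : Real.cos (G (x 0, x 1)).2 = 0 :=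
        (mul_eq_zero.1 hw).resolve_left (radius_pos _).ne'
      obtain ⟨j, hj⟩ := (cos_eq_zero_iff_of_mem_Ioo hmem).1 hcos
      refine ⟨j, ?_⟩
      have hx1 : chart l (0, s j) = x 1 := by
        refine Eq.trans (congrArg (chart l) ?_) h2
        exact Prod.ext (h0.symm.trans h1.symm) hj.symm
      ext i
      refine Fin.cases ?_ (fun i => Fin.cases ?_ (fun i => ?_) i) i
      · exact h0.symm
      · exact hx1
      · exact (hi i).symm
    · rintro ⟨j, rfl⟩
      refine ⟨he0 j, ?_, fun i => rfl⟩
      rw [he0, he1]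
      change cosCoord (G (0, chart l (0, s j))) = 0
      rw [hVG (0, s j) (hsmem j), cosCoord,
        (cos_eq_zero_iff_of_mem_Ioo (hsmem j)).2 ⟨j, rfl⟩, mul_zero]
  rw [hrange, ← Set.image_univ, hinj.encard_image, Set.encard_univ]
  simp

/-- If a flow has finitely many equilibria, all of them are isolated. -/
theorem isIsolatedEquilibrium_of_finite {k : ℕ} {Φ : Flow ℝ (Euc k)}
    (h : {x | IsEquilibrium Φ x}.Finite) {x : Euc k} (hx : IsEquilibrium Φ x) :
    IsIsolatedEquilibrium Φ x := by
  refine ⟨hx, ({y | IsEquilibrium Φ y} \ {x})ᶜ,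
    (h.subset Set.sdiff_subset).isClosed.isOpen_compl.mem_nhds (by simp), fun y hy hy' => ?_⟩
  by_contra hne
  exact hy ⟨hy', hne⟩

end SuperLinear

theorem theorem1 (k : ℕ) (hk : 1 < k) (l : ℕ) :
    ∃ Φ : Flow ℝ (SuperLinear.Euc k),
      SuperLinear.IsSmoothFlow Φ ∧
      {x | SuperLinear.IsEquilibrium Φ x}.encard = l ∧
      (∀ x, SuperLinear.IsEquilibrium Φ x → SuperLinear.IsIsolatedEquilibrium Φ x) ∧
      SuperLinear.IsSuperLinearizable Φ := by
  obtain ⟨d, rfl⟩ := Nat.exists_eq_add_of_lt hk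
  rw [show 1 + d + 1 = d + 2 by omega]
  obtain ⟨Φ, h1, h2, h3⟩ : ∃ Φ : Flow ℝ (SuperLinear.Euc (d + 2)),
      SuperLinear.IsSmoothFlow Φ ∧ SuperLinear.IsSuperLinearizable Φ ∧
      {x | SuperLinear.IsEquilibrium Φ x}.encard = l := by
    rcases eq_or_ne l 0 with rfl | hl
    · exact SuperLinear.exists_flow_encard_zero d
    · exact SuperLinear.exists_flow_encard_eq d hl
  exact ⟨Φ, h1, h3, fun x hx => SuperLinear.isIsolatedEquilibrium_of_finite
    (Set.finite_of_encard_eq_coe h3) hx, h2⟩
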